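/- Let $V$ be a vertex operator algebra over $\mathbb C$ with vacuum vector $\mathbf 1$, conformal vector $\omega$ and central charge $c$. For $a\in V$ write $Y(a,z)=\sum_{n\in\mathbb Z}a_{(n)}z^{-n-1}$, and put $L_m=\omega_{(m+1)}$. Assume that $L_0$ is semisimple and that $V=\bigoplus_{n\ge 0}V^n$, where $V^n$ is the eigenspace of $L_0$ with eigenvalue $n$ and is finite-dimensional; assume moreover that $V^0=\mathbb C\mathbf 1$ and $V^1=0$. Let $B=V^2$ be the Griess algebra, with the bilinear form given by $(a|b)\mathbf 1=a_{(3)}b$ for $a,b\in B$. For $u\in V^n$ let $o(u)=u_{(n-1)}$, which preserves every $V^k$; for an operator $f$ on $V$ preserving every $V^k$ let $\mathrm{Tr}\, f q^{L_0}=\sum_{k\ge 0}(\mathrm{Tr}|_{V^k}f)\,q^k$, and let $\mathrm{ch}\,V=\sum_{k\ge0}(\dim V^k)q^k$; these are formal power series in $q$. Let $$E_{2k}=-\frac{B_{2k}}{(2k)!}+\frac{2}{(2k-1)!}\sum_{n\ge 1}\Bigl(\sum_{d\mid n}d^{2k-1}\Bigr)q^n,\qquad \frac{t}{e^t-1}=\sum_{m\ge0}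 B_m\frac{t^m}{m!}.$$ Let $\mathrm{Aut}\,V$ be the group of linear automorphisms $g$ of $V$ with $g(a_{(n)}b)=(ga)_{(n)}(gb)$ for all $a,b\in V$, $n\in\mathbb Z$, and $g\omega=\omega$. Let $V_\omega$ be the smallest subspace of $V$ that contains $\mathbf 1$ and is stable under all $L_m$, $m\in\mathbb Z$; put $V^{\le n}=\bigoplus_{m\le n}V^m$ and $V_\omega^{\le n}=V_\omega\cap V^{\le n}$. The algebra $V$ is said to be of class $\mathcal S^n$ if $0$ is the only vector of $V^{\le n}/V_\omega^{\le n}$ fixed by $\mathrm{Aut}\,V$. Suppose that $\mathrm{Aut}\,V$ is finite. (1) If $V$ is of class $\mathcal S^2$ and $c\neq0$, then for every $a\in B$ $$\mathrm{Tr}\,o(a)q^{L_0}=\frac{2(a|\omega)}{c}\,q\frac{d}{dq}\,\mathrm{ch}\,V.$$ (2) If $V$ is of class $\mathcal S^4$ and $c(5c+22)\ne0$, then for all $a,b\in B$ $$\begin{aligned}\mathrm{Tr}\,o(a)o(b)q^{L_0}={}&\frac{44(a|b)+20(a|\omega)(b|\omega)}{c(5c+22)}\Bigl(q\frac{d}{dq}\Bigr)^2\mathrm{ch}\,V\\&-\frac{c(a|b)-2(a|\omega)(b|\omega)}{3c(5c+22)}\,(11+60E_2)\,q\frac{d}{dq}\,\mathrm{ch}\,V\\&+\frac{c(a|b)-2(a|\omega)(b|\omega)}{144(5c+22)}\,(11+120E_2-720E_4)\,\mathrm{ch}\,V.\end{aligned}$$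 -/

import Mathlib

open scoped PowerSeries

noncomputable section

/-- The mode `a_(n)`, i.e. the coefficient of `z ^ (-n-1)` in `Y(a, z)`. -/
def vertexMode {V : Type*} [AddCommGroup V] [Module ℂ V]
    (Y : V →ₗ[ℂ] VertexOperator ℂ V) (a : V) (n : ℤ) : Module.End ℂ V :=
  VertexOperator.ncoeff (Y a) n

/-- A vertex operator algebra structure on the complex vector space `V`, graded by the
nonnegative integers. The state-field map takes values in `VertexOperator ℂ V`, so for all `a`, `b`
one has `a_(n) b = 0` for large `n`; hence all the sums in `borcherds` are finite. -/
structure VertexOperatorAlgebra (V : Type*) [AddCommGroup V] [Module ℂ V] where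
  /-- The state-field map `a ↦ Y(a, z)`. -/
  Y : V →ₗ[ℂ] VertexOperator ℂ V
  /-- The vacuum vector. -/
  vac : V
  /-- The conformal vector. -/
  conf : V
  /-- The rank (central charge). -/
  c : ℂ
  vac_ne_zero : vac ≠ 0
  conf_ne_zero : conf ≠ 0
  /-- The Borcherds identity. -/
  borcherds : ∀ (a b v : V) (p q r : ℤ),
    (∑ᶠ i : ℕ, Ring.choose p i •
      vertexMode Y (vertexMode Y a (r + i) b) (p + q - i) v) =
    ∑ᶠ i : ℕ, ((-1 : ℤ) ^ i * Ring.choose r i) •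
      (vertexMode Y a (p + r - i) (vertexMode Y b (q + i) v) -
        (-1 : ℂ) ^ r • vertexMode Y b (q + r - i) (vertexMode Y a (p + i) v))
  vac_mode : ∀ (n : ℤ) (a : V), vertexMode Y vac n a = if n = -1 then a else 0
  mode_vac_of_nonneg : ∀ (a : V) (n : ℤ), 0 ≤ n → vertexMode Y a n vac = 0
  mode_vac_neg_one : ∀ a : V, vertexMode Y a (-1) vac = a
  /-- The operators `L_m = ω_(m+1)` satisfy the Virasoro relations. -/
  virasoro : ∀ m n : ℤ,
    vertexMode Y conf (m + 1) * vertexMode Y conf (n + 1) -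
        vertexMode Y conf (n + 1) * vertexMode Y conf (m + 1) =
      ((m : ℂ) - n) • vertexMode Y conf (m + n + 1) +
        if m + n = 0 then (((m : ℂ) ^ 3 - m) / 12 * c) • (1 : Module.End ℂ V) else 0
  /-- `(L_{-1} a)_(n) = -n a_(n-1)`. -/
  translation : ∀ (a : V) (n : ℤ),
    vertexMode Y (vertexMode Y conf 0 a) n = (-(n : ℂ)) • vertexMode Y a (n - 1)
  /-- `L_0 = ω_(1)` is semisimple with eigenvalues in `ℕ`. -/
  grading : DirectSum.IsInternal
    fun n : ℕ => Module.End.eigenspace (vertexMode Y conf 1) (n : ℂ)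
  finite_weight : ∀ n : ℕ,
    FiniteDimensional ℂ (Module.End.eigenspace (vertexMode Y conf 1) (n : ℂ))

namespace VertexOperatorAlgebra

variable {V : Type*} [AddCommGroup V] [Module ℂ V] (X : VertexOperatorAlgebra V)

/-- `X.mode a n` is the operator `a_(n)`. -/
def mode (a : V) (n : ℤ) : Module.End ℂ V := vertexMode X.Y a n

/-- The Virasoro operator `L_m = ω_(m+1)`. -/
def L (m : ℤ) : Module.End ℂ V := X.mode X.conf (m + 1)

/-- The space `V^n` of vectors of degree `n`. -/
def weight (n : ℕ) : Submodule ℂ V := Module.End.eigenspace (X.L 0) (n : ℂ)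

/-- The space `V^{≤ n}`. -/
def weightLE (n : ℕ) : Submodule ℂ V := ⨆ m ∈ Finset.range (n + 1), X.weight m

/-- The condition `V^0 = ℂ 1` and `V^1 = 0`. -/
structure HasGriessGrading : Prop where
  weight_zero : X.weight 0 = Submodule.span ℂ {X.vac}
  weight_one : X.weight 1 = ⊥

/-- The Virasoro submodule `V_ω` generated by the vacuum vector. -/
def virasoroSubmodule : Submodule ℂ V :=
  sInf {W : Submodule ℂ V | X.vac ∈ W ∧ ∀ (m : ℤ), ∀ v ∈ W, X.L m v ∈ W}

/-- The group `Aut V` of automorphisms of the vertex operator algebra. -/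
def Aut : Subgroup (V ≃ₗ[ℂ] V) where
  carrier := {g | (∀ (a b : V) (n : ℤ), g (X.mode a n b) = X.mode (g a) n (g b)) ∧
    g X.conf = X.conf}
  mul_mem' := by
    rintro g h ⟨hg, hg'⟩ ⟨hh, hh'⟩
    exact ⟨fun a b n => by simp [LinearEquiv.mul_apply, hh, hg],
      by simp [LinearEquiv.mul_apply, hh', hg']⟩
  one_mem' := ⟨fun _ _ _ => rfl, rfl⟩
  inv_mem' := by
    rintro g ⟨hg, hg'⟩
    refine ⟨fun a b n => ?_, ?_⟩
    · apply g.injective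
      rw [hg]
      change g (g.symm _) = X.mode (g (g.symm a)) n (g (g.symm b))
      simp
    · apply g.injective
      rw [hg']
      change g (g.symm _) = _
      simp

/-- Class `S^n`: the action of `Aut V` on the quotient `V^{≤ n} / V_ω^{≤ n}` is fixed-point free,
i.e. the zero class is the only fixed one. -/
def IsClassS (n : ℕ) : Prop :=
  ∀ v ∈ X.weightLE n, (∀ g ∈ X.Aut, g v - v ∈ X.virasoroSubmodule ⊓ X.weightLE n) →
    v ∈ X.virasoroSubmodule ⊓ X.weightLE n

theorem mem_weight {n : ℕ} {v : V} : v ∈ X.weight n ↔ X.mode X.conf 1 v = (n : ℂ) • v :=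
  Module.End.mem_eigenspace_iff

/-- `[L_0, b_(q)] = (L_0 b)_(q) - (q + 1) b_(q)`. -/
theorem L_zero_mode (b v : V) (q : ℤ) :
    X.mode X.conf 1 (X.mode b q v) =
      X.mode b q (X.mode X.conf 1 v) + X.mode (X.mode X.conf 1 b) q v
        - ((q : ℂ) + 1) • X.mode b q v := by
  have h := X.borcherds X.conf b v 1 q 0
  rw [finsum_eq_sum_of_support_subset (s := Finset.range 2),
    finsum_eq_sum_of_support_subset (s := Finset.range 1)] at h
  · have ht := LinearMap.congr_fun (X.translation b (1 + q)) v
    simp only [Finset.sum_range_succ, Finset.range_zero, Finset.sum_empty, Nat.cast_zero,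
      Nat.cast_one, Ring.choose_zero_right, Ring.choose_one_right, zero_add, add_zero, sub_zero,
      one_smul, pow_zero, mul_one, zpow_zero, ht] at h
    simp only [mode]
    simp only [add_sub_cancel_left, LinearMap.smul_apply] at h
    rw [eq_comm, sub_eq_iff_eq_add] at h
    rw [h]
    push_cast
    module
  · intro i hi
    by_contra hn
    have : 0 < i := by simp at hn; omega
    apply hi
    have h0 : Ring.choose (0 : ℤ) i = 0 := by
      exact Ring.choose_zero_pos ℤ this
    simp [h0]
  · intro i hi
    by_contra hn
    have h2 : 1 < i := by simp at hn; omega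
    apply hi
    have h0 : Ring.choose (1 : ℤ) i = 0 := by
      have := Ring.choose_natCast (R := ℤ) 1 i
      simpa [Nat.choose_eq_zero_of_lt h2] using this
    simp [h0]

/-- `V^i_(n) V^j ⊆ V^{i+j-n-1}`. -/
theorem mode_mem_weight {i j k : ℕ} {n : ℤ} (h : (k : ℤ) = i + j - n - 1) {a b : V}
    (ha : a ∈ X.weight i) (hb : b ∈ X.weight j) : X.mode a n b ∈ X.weight k := by
  rw [mem_weight] at *
  rw [L_zero_mode, ha, hb]
  have hk : (k : ℂ) = i + j - n - 1 := by exact_mod_cast congrArg (Int.cast : ℤ → ℂ) h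
  have hm : X.mode ((i : ℂ) • a) n b = (i : ℂ) • X.mode a n b := by
    simp [mode, vertexMode]
  rw [hm, map_smul, hk]
  module

theorem conf_mem_weight : X.conf ∈ X.weight 2 := by
  rw [mem_weight]
  have h := LinearMap.congr_fun (X.virasoro 0 (-2)) X.vac
  have h1 := X.mode_vac_of_nonneg X.conf 1 (by norm_num)
  have h2 := X.mode_vac_neg_one X.conf
  norm_num [h1, h2] at h
  simpa [mode] using h

/-- The Griess algebra `B = V^2`. -/
abbrev griess : Submodule ℂ V := X.weight 2

/-- The conformal vector as an element of `B`. -/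
def confB : X.griess := ⟨X.conf, X.conf_mem_weight⟩

variable {X} in
theorem HasGriessGrading.exists_form (hX : X.HasGriessGrading) (a b : X.griess) :
    ∃ r : ℂ, r • X.vac = X.mode a 3 b := by
  have h : X.mode a 3 b ∈ X.weight 0 := X.mode_mem_weight (by norm_num) a.2 b.2
  rw [hX.weight_zero] at h
  exact Submodule.mem_span_singleton.1 h

variable {X} in
/-- The bilinear form on `B`, given by `(a|b) 1 = a_(3) b`. -/
def HasGriessGrading.form (hX : X.HasGriessGrading) (a b : X.griess) : ℂ :=
  (hX.exists_form a b).choose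

variable {X} in
theorem HasGriessGrading.form_smul_vac (hX : X.HasGriessGrading) (a b : X.griess) :
    hX.form a b • X.vac = X.mode a 3 b :=
  (hX.exists_form a b).choose_spec

/-- The degree-preserving operators on `V`. -/
def PreservesDegree (f : Module.End ℂ V) : Prop :=
  ∀ n : ℕ, ∀ v ∈ X.weight n, f v ∈ X.weight n

variable {X} in
theorem PreservesDegree.mul {f g : Module.End ℂ V} (hf : X.PreservesDegree f)
    (hg : X.PreservesDegree g) : X.PreservesDegree (f * g) :=
  fun n v hv => hf n _ (hg n v hv)

/-- `Tr f q^{L_0} = ∑ n, (Tr f|_{V^n}) q^n`, for a degree-preserving operator `f`. -/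
def traceSeries (f : Module.End ℂ V) (hf : X.PreservesDegree f) : ℂ⟦X⟧ :=
  PowerSeries.mk fun n => LinearMap.trace ℂ (X.weight n) (f.restrict (hf n))

/-- The operator `o(u) = u_(n-1)`, for `u ∈ V^n`. -/
def o {n : ℕ} (u : X.weight n) : Module.End ℂ V := X.mode u ((n : ℤ) - 1)

theorem preservesDegree_o {n : ℕ} (u : X.weight n) : X.PreservesDegree (X.o u) :=
  fun _ _ hv => X.mode_mem_weight (by ring) u.2 hv

/-- The character `ch V = ∑ n, (dim V^n) q^n`. -/
def ch : ℂ⟦X⟧ := PowerSeries.mk fun n => (Module.finrank ℂ (X.weight n) : ℂ)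

end VertexOperatorAlgebra

/-- The Euler operator `q d/dq` on power series in `q`. -/
def qDeriv (f : ℂ⟦X⟧) : ℂ⟦X⟧ := PowerSeries.X * PowerSeries.derivative ℂ f

/-- For `k ≥ 1`, the `q`-expansion
`E_{2k} = -B_{2k} / (2k)! + (2 / (2k-1)!) ∑_{n ≥ 1} σ_{2k-1}(n) q^n`
of the Eisenstein series of weight `2k`; the argument `w` is the weight `2k`. -/
def eisensteinQ (w : ℕ) : ℂ⟦X⟧ :=
  PowerSeries.mk fun n =>
    if n = 0 then -((bernoulli w : ℚ) : ℂ) / (w.factorial : ℂ)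
    else 2 / ((w - 1).factorial : ℂ) * ((∑ d ∈ n.divisors, d ^ (w - 1) : ℕ) : ℂ)

end

/-! An automorphism $g$ conjugates $o(u)$ into $o(gu)$, so every $\mathrm{Tr}|_{V^m}o(u)$ is
unchanged when $u$ is replaced by its average over the finite group $\mathrm{Aut}\,V$. The class
condition puts this average in $V_\omega$: in degree 2 it is a multiple of $\omega$, in degree 4 a
combination of $L_{-4}\mathbf 1$ and $\omega_{(-1)}\omega$ (`IsClassS.average_mem`). Applying $L_2$,
or $L_4$ and $L_2^2$, to it fixes the coefficients. Since $o(\omega)=L_0$ acts on traces as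
$q\,d/dq$, part (1) follows.

For part (2), the Borcherds identity writes $(a_{(-1)}b)_{(3)}$ as a sum of products of modes, among
them $o(b)o(a)$. For $k\ge1$, cyclicity of the trace gives $P=q^k(P+C)$, where $P$ is the trace
series of $a_{(1-k)}b_{(1+k)}$ and $C$ a commutator trace. Summing $P=\frac{q^k}{1-q^k}C$ over $k$
produces divisor sums, hence $E_2$ and $E_4$ (`blockTraceSeries_mode_mul_mode`). The only unknown
left is the trace of $(\omega_{(-1)}\omega)_{(3)}$. The same formula at $a=b=\omega$, where the
product of zero modes is $L_0^2$, determines it (`trace_product_elimination`). -/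

noncomputable section

/-! ### Integer grading, traces on graded pieces, and the commutator formula -/

namespace VertexOperatorAlgebra

variable {V : Type*} [AddCommGroup V] [Module ℂ V] (X : VertexOperatorAlgebra V)

/-- The eigenspace of `L_0` for an integer eigenvalue. -/
def intWeight (m : ℤ) : Submodule ℂ V := Module.End.eigenspace (X.L 0) (m : ℂ)

theorem intWeight_natCast (n : ℕ) : X.intWeight n = X.weight n := by
  simp [intWeight, weight]

theorem mem_intWeight {m : ℤ} {v : V} :
    v ∈ X.intWeight m ↔ X.mode X.conf 1 v = (m : ℂ) • v :=
  Module.End.mem_eigenspace_iff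

theorem isInternal_weight : DirectSum.IsInternal X.weight := X.grading

/-- Eigenspaces are independent, and those for natural eigenvalues already span $V$. -/
theorem intWeight_eq_bot {m : ℤ} (hm : m < 0) : X.intWeight m = ⊥ := by
  have h := Module.End.eigenspaces_iSupIndep (X.L 0) (m : ℂ)
  have htop : (⊤ : Submodule ℂ V) ≤ ⨆ (μ : ℂ) (_ : μ ≠ (m : ℂ)), Module.End.eigenspace (X.L 0) μ := by
    rw [← X.isInternal_weight.submodule_iSup_eq_top]
    refine iSup_le fun n => ?_
    refine le_iSup₂_of_le (n : ℂ) ?_ le_rfl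
    intro h'
    have : (n : ℤ) = m := by exact_mod_cast h'
    omega
  exact (h.mono_right htop).eq_bot_of_le le_top

instance (m : ℤ) : FiniteDimensional ℂ (X.intWeight m) := by
  rcases lt_or_ge m 0 with hm | hm
  · rw [X.intWeight_eq_bot hm]; infer_instance
  · lift m to ℕ using hm
    rw [intWeight_natCast]
    exact X.finite_weight m

theorem mode_mem_intWeight {i j k n : ℤ} (h : k = i + j - n - 1) {a b : V}
    (ha : a ∈ X.intWeight i) (hb : b ∈ X.intWeight j) : X.mode a n b ∈ X.intWeight k := by
  rw [mem_intWeight] at *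
  rw [L_zero_mode, ha, hb]
  have hk : (k : ℂ) = i + j - n - 1 := by exact_mod_cast congrArg (Int.cast : ℤ → ℂ) h
  have hm : X.mode ((i : ℂ) • a) n b = (i : ℂ) • X.mode a n b := by
    simp [mode, vertexMode]
  rw [hm, map_smul, hk]
  module

theorem mode_eq_zero {i j n : ℤ} (h : i + j - n - 1 < 0) {a b : V}
    (ha : a ∈ X.intWeight i) (hb : b ∈ X.intWeight j) : X.mode a n b = 0 := by
  have := X.mode_mem_intWeight (n := n) rfl ha hb
  rwa [X.intWeight_eq_bot h, Submodule.mem_bot] at this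

/-- The modes as a linear function of the state. -/
def modeL (n : ℤ) : V →ₗ[ℂ] Module.End ℂ V where
  toFun a := X.mode a n
  map_add' a b := by ext; simp [mode, vertexMode]
  map_smul' r a := by ext; simp [mode, vertexMode]

theorem mode_add (a b : V) (n : ℤ) : X.mode (a + b) n = X.mode a n + X.mode b n :=
  (X.modeL n).map_add a b

theorem mode_smul (r : ℂ) (a : V) (n : ℤ) : X.mode (r • a) n = r • X.mode a n :=
  (X.modeL n).map_smul r a

theorem mode_zero (n : ℤ) : X.mode 0 n = 0 := (X.modeL n).map_zero

/-- The trace of the diagonal block of an operator on the space of degree `m`. -/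
def blockTrace (m : ℤ) : Module.End ℂ V →ₗ[ℂ] ℂ where
  toFun f := LinearMap.trace ℂ (X.intWeight m)
    ((X.intWeight m).subtype.leftInverse ∘ₗ f ∘ₗ (X.intWeight m).subtype)
  map_add' f g := by rw [← map_add]; congr 1; ext; simp
  map_smul' r f := by simp only [RingHom.id_apply]; rw [← map_smul]; congr 1; ext; simp

/-- The left inverse in `blockTrace` is an arbitrary projection, which makes the trace linear in all
operators. On degree-preserving ones the choice does not matter. -/
theorem leftInverse_apply {W : Submodule ℂ V} {v : V} (hv : v ∈ W) :
    (W.subtype.leftInverse v : V) = v :=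
  congrArg Subtype.val
    (LinearMap.leftInverse_apply_of_inj (f := W.subtype) (Submodule.ker_subtype W) ⟨v, hv⟩)

theorem blockTrace_congr {m : ℤ} {f g : Module.End ℂ V} (h : ∀ v ∈ X.intWeight m, f v = g v) :
    X.blockTrace m f = X.blockTrace m g := by
  simp only [blockTrace, LinearMap.coe_mk, AddHom.coe_mk]
  congr 1
  ext v
  simp [h v v.2]

theorem blockTrace_of_neg {m : ℤ} (hm : m < 0) (f : Module.End ℂ V) : X.blockTrace m f = 0 := by
  rw [X.blockTrace_congr (g := 0), map_zero]
  intro v hv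
  rw [X.intWeight_eq_bot hm, Submodule.mem_bot] at hv
  simp [hv]

/-- Cyclicity between different degrees is what shifts the exponent of $q$ in the recursions below.
-/
theorem blockTrace_mul_comm {m n : ℤ} {f g : Module.End ℂ V}
    (hf : ∀ v ∈ X.intWeight m, f v ∈ X.intWeight n)
    (hg : ∀ v ∈ X.intWeight n, g v ∈ X.intWeight m) :
    X.blockTrace m (g * f) = X.blockTrace n (f * g) := by
  have key : ∀ {m n : ℤ} {f g : Module.End ℂ V}
    (hf : ∀ v ∈ X.intWeight m, f v ∈ X.intWeight n)
    (hg : ∀ v ∈ X.intWeight n, g v ∈ X.intWeight m),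
      X.blockTrace m (g * f) = LinearMap.trace ℂ (X.intWeight m)
        (g.restrict hg ∘ₗ f.restrict hf) := by
    intro m n f g hf hg
    simp only [blockTrace, LinearMap.coe_mk, AddHom.coe_mk]
    congr 1
    ext v
    simp [leftInverse_apply (hg _ (hf _ v.2))]
  rw [key hf hg, key hg hf, LinearMap.trace_comp_comm']

theorem coeff_traceSeries (f : Module.End ℂ V) (hf : X.PreservesDegree f) (n : ℕ) :
    PowerSeries.coeff n (X.traceSeries f hf) = X.blockTrace n f := by
  have key : ∀ (W W' : Submodule ℂ V) (_ : W = W') (h : ∀ v ∈ W, f v ∈ W),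
      LinearMap.trace ℂ W (f.restrict h) =
        LinearMap.trace ℂ W' (W'.subtype.leftInverse ∘ₗ f ∘ₗ W'.subtype) := by
    rintro W _ rfl h
    congr 1
    ext v
    simp [leftInverse_apply (h _ v.2)]
  rw [traceSeries, PowerSeries.coeff_mk]
  exact key _ _ (X.intWeight_natCast n).symm (hf n)

theorem blockTrace_one (n : ℕ) : X.blockTrace n 1 = PowerSeries.coeff n X.ch := by
  have h : X.PreservesDegree 1 := fun _ _ hv => hv
  have : FiniteDimensional ℂ (X.weight n) := X.finite_weight n
  rw [← X.coeff_traceSeries 1 h, traceSeries, ch, PowerSeries.coeff_mk, PowerSeries.coeff_mk,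
    ← LinearMap.trace_one]
  rfl

theorem coeff_qDeriv (f : ℂ⟦X⟧) (n : ℕ) :
    PowerSeries.coeff n (qDeriv f) = n * PowerSeries.coeff n f := by
  cases n with
  | zero => simp [qDeriv]
  | succ n =>
    rw [qDeriv, PowerSeries.coeff_succ_X_mul, PowerSeries.coeff_derivative]
    push_cast; ring

theorem blockTrace_conf_mul (n : ℕ) (f : Module.End ℂ V) :
    X.blockTrace n (f * X.mode X.conf 1) = n * X.blockTrace n f := by
  rw [X.blockTrace_congr (g := (n : ℂ) • f), map_smul, smul_eq_mul]
  intro v hv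
  rw [mem_intWeight] at hv
  simp [hv]

theorem blockTrace_conf (n : ℕ) :
    X.blockTrace n (X.mode X.conf 1) = PowerSeries.coeff n (qDeriv X.ch) := by
  rw [coeff_qDeriv, ← blockTrace_one, ← blockTrace_conf_mul, one_mul]

/-- The Borcherds identity at $r=0$: since $\binom0i=0$ for $i>0$, only the commutator survives on
the right. -/
theorem commutator_formula {a b : V} {N : ℕ} (h : ∀ i : ℕ, N ≤ i → X.mode a i b = 0)
    (p q : ℤ) (v : V) :
    X.mode a p (X.mode b q v) - X.mode b q (X.mode a p v) =
      ∑ i ∈ Finset.range N, Ring.choose p i • X.mode (X.mode a i b) (p + q - i) v := by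
  have hb := X.borcherds a b v p q 0
  rw [finsum_eq_sum_of_support_subset (s := Finset.range N),
    finsum_eq_sum_of_support_subset (s := Finset.range 1)] at hb
  · simp only [Finset.sum_range_one, Nat.cast_zero, Ring.choose_zero_right, zero_add, add_zero,
      sub_zero, one_smul, pow_zero, mul_one, zpow_zero] at hb
    exact hb.symm
  · intro i hi
    by_contra hn
    have : 0 < i := by simp at hn; omega
    apply hi
    simp [Ring.choose_zero_pos ℤ this]
  · intro i hi
    by_contra hn
    apply hi
    have := h i (by simpa using hn)
    rw [mode] at this
    dsimp only
    rw [zero_add, this]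
    simp [vertexMode]

/-- Serves the Borcherds identity at $r=-1$, which thus has all binomial coefficients equal to 1. -/
theorem choose_neg_one (i : ℕ) : (-1 : ℤ) ^ i * Ring.choose (-1 : ℤ) i = 1 := by
  have h := Ring.choose_natCast (R := ℤ) i i
  rw [Ring.choose_neg, add_sub_cancel_left, h, Nat.choose_self, Units.smul_def]
  simp [Int.negOnePow_def, ← mul_pow]
end VertexOperatorAlgebra

/-! ### Lambert series and divisor sums -/

/-- The Lambert-type series `∑ q ^ m` over the positive multiples `m` of `k`. -/
def multiplesSeries (k : ℕ) : ℂ⟦X⟧ := PowerSeries.mk fun m => if m ≠ 0 ∧ k ∣ m then 1 else 0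

/-- The generating function of the divisor power sums. -/
def sigmaSeries (e : ℕ) : ℂ⟦X⟧ := PowerSeries.mk fun m => ∑ d ∈ m.divisors, (d : ℂ) ^ e

theorem multiplesSeries_eq {k : ℕ} (hk : k ≠ 0) :
    multiplesSeries k = PowerSeries.X ^ k * (multiplesSeries k + 1) := by
  ext n
  rw [PowerSeries.coeff_X_pow_mul']
  simp only [multiplesSeries, map_add, PowerSeries.coeff_mk, PowerSeries.coeff_one]
  split_ifs with h1 h2 h3 h4 h3 h4 h5 h5
  · omega
  · simp
  · simp
  · exfalso
    have : k ∣ n - k := Nat.dvd_sub h1.2 dvd_rfl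
    tauto
  · exact absurd (Nat.le_of_dvd (by omega) h1.2) h2
  · omega
  · have hkn : k ∣ n - k := And.right ‹n - k ≠ 0 ∧ k ∣ n - k›
    exact absurd ⟨by omega, (Nat.dvd_sub_iff_left ‹k ≤ n› dvd_rfl).1 hkn⟩ h1
  · exact absurd ⟨by omega, by rw [show n = k by omega]⟩ h1
  · simp
  · rfl

/-- `multiplesSeries k` is $q^k/(1-q^k)$, and $1-q^k$ can be cancelled in a domain. -/
theorem eq_multiplesSeries_mul {k : ℕ} (hk : k ≠ 0) {P R : ℂ⟦X⟧}
    (h : P = PowerSeries.X ^ k * (P + R)) : P = multiplesSeries k * R := by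
  have h1 : (1 - PowerSeries.X ^ k : ℂ⟦X⟧) ≠ 0 := by
    intro h0
    have := congrArg (PowerSeries.coeff 0) h0
    simp [hk] at this
  have h2 := multiplesSeries_eq hk
  have h3 : (1 - PowerSeries.X ^ k : ℂ⟦X⟧) * (P - multiplesSeries k * R) = 0 := by
    linear_combination h - R * h2
  rcases mul_eq_zero.1 h3 with h4 | h4
  · exact absurd h4 h1
  · exact sub_eq_zero.1 h4

theorem sum_divisors_pow {m N : ℕ} (h : m ≤ N) (e : ℕ) :
    ∑ i ∈ Finset.range N, ((i + 1 : ℕ) : ℂ) ^ e * (if m ≠ 0 ∧ (i + 1) ∣ m then 1 else 0) =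
      ∑ d ∈ m.divisors, (d : ℂ) ^ e := by
  rcases eq_or_ne m 0 with rfl | hm
  · simp
  rw [Finset.range_eq_Ico, Finset.sum_Ico_add' (fun d : ℕ =>
    (d : ℂ) ^ e * (if m ≠ 0 ∧ d ∣ m then 1 else 0)) 0 N 1]
  simp only [mul_ite, mul_one, mul_zero]
  rw [← Finset.sum_filter]
  refine Finset.sum_congr ?_ fun _ _ => rfl
  ext d
  simp only [Finset.mem_filter, Finset.mem_Ico, Nat.mem_divisors]
  constructor
  · tauto
  · rintro ⟨h1, -⟩
    have := Nat.pos_of_dvd_of_pos h1 (by omega)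
    have := Nat.le_of_dvd (by omega) h1
    exact ⟨by omega, hm, h1⟩

/-- Lambert's identity $\sum_k k^e\frac{q^k}{1-q^k}=\sum_m\sigma_e(m)q^m$, truncated: terms with
$k>n$ do not reach the coefficient of $q^n$. -/
theorem sum_coeff_multiplesSeries_mul {n N : ℕ} (h : n ≤ N) (e : ℕ) (F : ℂ⟦X⟧) :
    ∑ i ∈ Finset.range N,
      ((i + 1 : ℕ) : ℂ) ^ e * PowerSeries.coeff n (multiplesSeries (i + 1) * F) =
      PowerSeries.coeff n (sigmaSeries e * F) := by
  simp only [PowerSeries.coeff_mul, Finset.mul_sum]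
  rw [Finset.sum_comm]
  refine Finset.sum_congr rfl fun x hx => ?_
  have hx' : x.1 ≤ N := (Finset.HasAntidiagonal.mem_antidiagonal.1 hx ▸ Nat.le_add_right _ _ :
    x.1 ≤ n).trans h
  simp only [sigmaSeries, multiplesSeries, PowerSeries.coeff_mk]
  rw [← sum_divisors_pow hx', Finset.sum_mul]
  exact Finset.sum_congr rfl fun i _ => by ring

theorem intCast_choose_three (p : ℤ) :
    ((Ring.choose p 3 : ℤ) : ℂ) = p * (p - 1) * (p - 2) / 6 := by
  have h := Ring.descPochhammer_eq_factorial_smul_choose p 3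
  have h2 : p * (p - 1) * (p - 2) = 6 * Ring.choose p 3 := by
    simpa [descPochhammer_succ_right, Nat.factorial, Polynomial.smeval_natCast, -Nat.cast_ofNat, mul_assoc,
      Polynomial.smeval_mul, Polynomial.smeval_sub, Polynomial.smeval_X] using h
  have h3 : (p : ℂ) * (p - 1) * (p - 2) = 6 * ((Ring.choose p 3 : ℤ) : ℂ) := by exact_mod_cast h2
  rw [h3]; ring

/-! ### Griess algebra commutators and the trace of a product of zero modes -/

namespace VertexOperatorAlgebra

variable {V : Type*} [AddCommGroup V] [Module ℂ V] {X : VertexOperatorAlgebra V}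

theorem griess_mem_intWeight (a : X.griess) : (a : V) ∈ X.intWeight 2 := by
  have := X.intWeight_natCast 2
  rw [Nat.cast_ofNat] at this
  rw [this]; exact a.2

namespace HasGriessGrading

theorem intWeight_one (hX : X.HasGriessGrading) : X.intWeight 1 = ⊥ := by
  have := X.intWeight_natCast 1
  rw [Nat.cast_one] at this
  rw [this, hX.weight_one]

theorem mode_two (hX : X.HasGriessGrading) (a b : X.griess) : X.mode a 2 (b : V) = 0 := by
  have := X.mode_mem_intWeight (n := 2) (k := 1) (by norm_num) (griess_mem_intWeight a)
    (griess_mem_intWeight b)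
  rwa [hX.intWeight_one, Submodule.mem_bot] at this

/-- The products $a_{(i)}b$ lie in $V^{3-i}$, so $i=2$ drops out by $V^1=0$ and $i=3$ gives the
form. -/
theorem griess_commutator (hX : X.HasGriessGrading) (a b : X.griess) (p q : ℤ) (v : V) :
    X.mode a p (X.mode b q v) - X.mode b q (X.mode a p v) =
      X.mode (X.mode a 0 b) (p + q) v + (p : ℂ) • X.mode (X.mode a 1 b) (p + q - 1) v +
        ((p : ℂ) * (p - 1) * (p - 2) / 6 * hX.form a b) • X.mode X.vac (p + q - 3) v := by
  rw [X.commutator_formula (N := 4) (fun i hi => X.mode_eq_zero (by omega)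
    (griess_mem_intWeight a) (griess_mem_intWeight b))]
  have h2 := hX.mode_two a b
  simp only [Finset.sum_range_succ, Finset.range_zero, Finset.sum_empty, zero_add, Nat.cast_zero,
    Nat.cast_one, Nat.cast_ofNat, Ring.choose_zero_right, Ring.choose_one_right, sub_zero,
    one_smul, h2, X.mode_zero, LinearMap.zero_apply, smul_zero, add_zero,
    ← hX.form_smul_vac a b, X.mode_smul, LinearMap.smul_apply]
  rw [← intCast_choose_three, mul_smul, Int.cast_smul_eq_zsmul, Int.cast_smul_eq_zsmul]

theorem form_eq (hX : X.HasGriessGrading) {a b : X.griess} {r : ℂ}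
    (h : X.mode a 3 (b : V) = r • X.vac) : hX.form a b = r :=
  smul_left_injective ℂ X.vac_ne_zero ((hX.form_smul_vac a b).trans h)

theorem form_comm (hX : X.HasGriessGrading) (a b : X.griess) : hX.form a b = hX.form b a := by
  apply hX.form_eq
  -- On the vacuum the left side is $-a_{(3)}b$, and the right side is $\binom{-1}{3}(b|a)\mathbf
  -- 1=-(b|a)\mathbf 1$.
  have h := hX.griess_commutator b a (-1) 3 X.vac
  have e1 : X.mode b 3 X.vac = 0 := X.mode_vac_of_nonneg b 3 (by norm_num)
  have e2 : X.mode a 3 X.vac = 0 := X.mode_vac_of_nonneg a 3 (by norm_num)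
  have e3 : X.mode b (-1) X.vac = b := X.mode_vac_neg_one b
  have e4 : X.mode X.vac (-1) X.vac = X.vac := X.mode_vac_neg_one _
  have e5 : X.mode (X.mode b 0 a) 2 X.vac = 0 := X.mode_vac_of_nonneg (X.mode b 0 a) 2 (by norm_num)
  have e6 : X.mode (X.mode b 1 a) 1 X.vac = 0 := X.mode_vac_of_nonneg (X.mode b 1 a) 1 (by norm_num)
  norm_num [e1, e2, e3, e4, e5, e6] at h
  exact h

theorem conf_commutator (hX : X.HasGriessGrading) (a : X.griess) (p q : ℤ) (v : V) :
    X.mode X.conf p (X.mode a q v) = X.mode a q (X.mode X.conf p v) +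
      ((p : ℂ) - q) • X.mode a (p + q - 1) v +
        ((p : ℂ) * (p - 1) * (p - 2) / 6 * hX.form a X.confB) • X.mode X.vac (p + q - 3) v := by
  have h := hX.griess_commutator X.confB a p q v
  have h1 : X.mode X.confB 1 (a : V) = (2 : ℂ) • (a : V) := by
    have := X.mem_weight.1 a.2
    exact_mod_cast this
  have h0 : X.mode (X.mode X.confB 0 (a : V)) (p + q) v =
      (-((p + q : ℤ) : ℂ)) • X.mode a (p + q - 1) v :=
    LinearMap.congr_fun (X.translation a (p + q)) v
  rw [h0, h1, X.mode_smul, hX.form_comm, sub_eq_iff_eq_add] at h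
  change X.mode X.conf p (X.mode a q v) = _ + X.mode a q (X.mode X.conf p v) at h
  rw [h]
  push_cast
  simp only [LinearMap.smul_apply]
  module

theorem blockTrace_griess_commutator (hX : X.HasGriessGrading) (a b : X.griess) {p q : ℤ}
    (hpq : p + q = 2) (n : ℤ) :
    X.blockTrace n (X.mode a p * X.mode b q) - X.blockTrace n (X.mode b q * X.mode a p) =
      (p - 1) * X.blockTrace n (X.mode (X.mode a 1 b) 1) +
        p * (p - 1) * (p - 2) / 6 * hX.form a b * X.blockTrace n 1 := by
  have key : ∀ {p q : ℤ} (hpq : p + q = 2),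
      X.blockTrace n (X.mode a p * X.mode b q) - X.blockTrace n (X.mode b q * X.mode a p) =
      X.blockTrace n (X.mode (X.mode a 0 b) 2) + p * X.blockTrace n (X.mode (X.mode a 1 b) 1) +
        p * (p - 1) * (p - 2) / 6 * hX.form a b * X.blockTrace n 1 := by
    intro p q hpq
    have : X.mode a p * X.mode b q - X.mode b q * X.mode a p =
        X.mode (X.mode a 0 b) 2 + (p : ℂ) • X.mode (X.mode a 1 b) 1 +
          ((p : ℂ) * (p - 1) * (p - 2) / 6 * hX.form a b) • 1 := by
      ext v
      have hv : X.mode X.vac (-1) v = v := by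
        have := X.vac_mode (-1) v
        rwa [if_pos rfl] at this
      have h := hX.griess_commutator a b p q v
      rw [hpq] at h
      norm_num only at h
      rw [hv] at h
      simpa using h
    rw [← map_sub, this]
    simp only [map_add, map_smul, smul_eq_mul]
  -- Two zero modes have a traceless commutator, so the trace of $(a_{(0)}b)_{(2)}$ is minus that of
  -- $(a_{(1)}b)_{(1)}$.
  have h0 := key (p := 1) (q := 1) rfl
  rw [X.blockTrace_mul_comm (m := n) (n := n)
    (fun v hv => X.mode_mem_intWeight (by ring) (griess_mem_intWeight b) hv)
    (fun v hv => X.mode_mem_intWeight (by ring) (griess_mem_intWeight a) hv)] at h0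
  rw [key hpq]
  push_cast at h0
  linear_combination -h0

theorem blockTrace_griess_mul_comm (a b : X.griess) {p q n m : ℤ} (hpq : p + q = 2)
    (hm : m = n + 1 - p) :
    X.blockTrace n (X.mode b q * X.mode a p) = X.blockTrace m (X.mode a p * X.mode b q) :=
  X.blockTrace_mul_comm
    (fun v hv => X.mode_mem_intWeight (by omega) (griess_mem_intWeight a) hv)
    (fun v hv => X.mode_mem_intWeight (by omega) (griess_mem_intWeight b) hv)

/-- The generating function of the traces of an operator on the graded pieces. -/
def _root_.VertexOperatorAlgebra.blockTraceSeries (X : VertexOperatorAlgebra V)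
    (f : Module.End ℂ V) : ℂ⟦X⟧ := PowerSeries.mk fun n => X.blockTrace n f

theorem coeff_blockTraceSeries (f : Module.End ℂ V) (n : ℕ) :
    PowerSeries.coeff n (X.blockTraceSeries f) = X.blockTrace n f := PowerSeries.coeff_mk _ _

/-- The trace function of the commutator of the modes `a_(k+1)` and `b_(-k+1)`. -/
def commutatorSeries (hX : X.HasGriessGrading) (a b : X.griess) (k : ℕ) : ℂ⟦X⟧ :=
  (k : ℂ) • X.blockTraceSeries (X.mode (X.mode a 1 b) 1) +
    (((k : ℂ) ^ 3 - k) / 6 * hX.form a b) • X.ch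

theorem coeff_commutatorSeries (hX : X.HasGriessGrading) (a b : X.griess) (k n : ℕ) :
    PowerSeries.coeff n (hX.commutatorSeries a b k) =
      k * X.blockTrace n (X.mode (X.mode a 1 b) 1) +
        ((k : ℂ) ^ 3 - k) / 6 * hX.form a b * X.blockTrace n 1 := by
  simp [commutatorSeries, coeff_blockTraceSeries, X.blockTrace_one]

/-- As $a_{(k+1)}$ lowers degree by $k$, cyclicity moves the trace from degree $n$ to $n-k$.
Restoring the order there costs a commutator. -/
theorem blockTraceSeries_lower_raise (hX : X.HasGriessGrading) (a b : X.griess) {k : ℕ}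
    (hk : k ≠ 0) :
    X.blockTraceSeries (X.mode b (-k + 1) * X.mode a (k + 1)) =
      multiplesSeries k * hX.commutatorSeries a b k := by
  apply eq_multiplesSeries_mul hk
  ext n
  rw [PowerSeries.coeff_X_pow_mul', coeff_blockTraceSeries,
    blockTrace_griess_mul_comm a b (m := n - k) (by ring) (by ring)]
  split_ifs with h
  · rw [map_add, coeff_blockTraceSeries, coeff_commutatorSeries, Nat.cast_sub h]
    have := hX.blockTrace_griess_commutator a b (p := k + 1) (q := -k + 1) (by ring) (n - k)
    push_cast at this
    linear_combination this
  · exact X.blockTrace_of_neg (by omega) _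

/-- The commutator trace is odd in $k$, so exchanging the roles of $a$ and $b$ yields the same
series. -/
theorem blockTraceSeries_raise_lower (hX : X.HasGriessGrading) (a b : X.griess) {k : ℕ}
    (hk : k ≠ 0) :
    X.blockTraceSeries (X.mode a (-k + 1) * X.mode b (k + 1)) =
      multiplesSeries k * hX.commutatorSeries a b k := by
  apply eq_multiplesSeries_mul hk
  ext n
  rw [PowerSeries.coeff_X_pow_mul', coeff_blockTraceSeries,
    blockTrace_griess_mul_comm b a (m := n - k) (by ring) (by ring)]
  split_ifs with h
  · rw [map_add, coeff_blockTraceSeries, coeff_commutatorSeries, Nat.cast_sub h]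
    have := hX.blockTrace_griess_commutator a b (p := -k + 1) (q := k + 1) (by ring) (n - k)
    push_cast at this
    linear_combination -this
  · exact X.blockTrace_of_neg (by omega) _

/-- The Borcherds identity at $p=0$, $q=3$, $r=-1$. The cutoff $n+2$ is the first $i$ for which
degree alone forces $a_{(i)}$ to kill $V^n$. -/
theorem mode_mode_neg_one (a b : X.griess) {n : ℕ} {v : V} (hv : v ∈ X.intWeight n) :
    X.mode (X.mode a (-1) b) 3 v = ∑ i ∈ Finset.range (n + 2),
      (X.mode a (-1 - i) (X.mode b (3 + i) v) + X.mode b (2 - i) (X.mode a i v)) := by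
  have h := X.borcherds a b v 0 3 (-1)
  rw [finsum_eq_sum_of_support_subset (s := Finset.range 1),
    finsum_eq_sum_of_support_subset (s := Finset.range (n + 2))] at h
  · simp only [Finset.sum_range_one, Ring.choose_zero_right, one_smul, choose_neg_one,
      Nat.cast_zero, add_zero, zero_add, sub_zero] at h
    refine h.trans (Finset.sum_congr rfl fun i _ => ?_)
    rw [zpow_neg_one, inv_neg, inv_one, neg_smul, one_smul, sub_neg_eq_add]
    norm_num only
    rfl
  · intro i hi
    by_contra hn
    have hn' : n + 2 ≤ i := by simpa using hn
    apply hi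
    have e1 := X.mode_eq_zero (n := 3 + i) (by omega) (griess_mem_intWeight b) hv
    have e2 := X.mode_eq_zero (n := 0 + i) (by omega) (griess_mem_intWeight a) hv
    dsimp only [mode] at e1 e2 ⊢
    rw [e1, e2]; simp
  · intro i hi
    by_contra hn
    have : 0 < i := by simp at hn; omega
    apply hi
    simp [Ring.choose_zero_pos ℤ this]

theorem sum_coeff_commutatorSeries (hX : X.HasGriessGrading) (a b : X.griess) {n N : ℕ}
    (h : n ≤ N) :
    ∑ i ∈ Finset.range N, PowerSeries.coeff n
        (multiplesSeries (i + 1) * hX.commutatorSeries a b (i + 1)) =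
      PowerSeries.coeff n (sigmaSeries 1 * X.blockTraceSeries (X.mode (X.mode a 1 b) 1) +
        (hX.form a b / 6) • ((sigmaSeries 3 - sigmaSeries 1) * X.ch)) := by
  rw [map_add, sub_mul, PowerSeries.coeff_smul, map_sub]
  simp only [← sum_coeff_multiplesSeries_mul h, smul_eq_mul]
  rw [← Finset.sum_sub_distrib, Finset.mul_sum, ← Finset.sum_add_distrib]
  refine Finset.sum_congr rfl fun i _ => ?_
  simp only [commutatorSeries, mul_add, mul_smul_comm, map_add, PowerSeries.coeff_smul,
    smul_eq_mul]
  ring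

/-- The trace of a product of two zero modes in terms of traces of single zero modes. -/
theorem blockTraceSeries_mode_mul_mode (hX : X.HasGriessGrading) (a b : X.griess) :
    X.blockTraceSeries (X.mode a 1 * X.mode b 1) =
      X.blockTraceSeries (X.mode (X.mode a (-1) b) 3) -
        (1 + 2 * sigmaSeries 1) * X.blockTraceSeries (X.mode (X.mode a 1 b) 1) -
        (hX.form a b / 3) • ((sigmaSeries 3 - sigmaSeries 1) * X.ch) := by
  ext n
  have h1 : X.blockTrace n (X.mode (X.mode a (-1) b) 3) = ∑ i ∈ Finset.range (n + 2),
      (X.blockTrace n (X.mode a (-1 - i) * X.mode b (3 + i)) +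
        X.blockTrace n (X.mode b (2 - i) * X.mode a i)) := by
    simp only [← map_add]
    rw [← map_sum]
    apply X.blockTrace_congr
    intro v hv
    rw [mode_mode_neg_one a b hv]
    simp
  -- This term comes in the wrong order for the recursions; reordering it is the source of the 1 in
  -- $1+2\sigma_1$.
  have h2 : X.blockTrace n (X.mode b 2 * X.mode a 0) =
      X.blockTrace n (X.mode a 0 * X.mode b 2) + X.blockTrace n (X.mode (X.mode a 1 b) 1) := by
    have := hX.blockTrace_griess_commutator a b (p := 0) (q := 2) (by ring) n
    push_cast at this
    linear_combination -this
  have h3 : X.blockTrace n (X.mode b 1 * X.mode a 1) =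
      X.blockTrace n (X.mode a 1 * X.mode b 1) :=
    blockTrace_griess_mul_comm a b (by ring) (by ring)
  have h4 : ∑ i ∈ Finset.range (n + 2), X.blockTrace n (X.mode a (-1 - i) * X.mode b (3 + i)) +
      X.blockTrace n (X.mode a 0 * X.mode b 2) =
      ∑ i ∈ Finset.range (n + 3), PowerSeries.coeff n
        (multiplesSeries (i + 1) * hX.commutatorSeries a b (i + 1)) := by
    rw [Finset.sum_range_succ' _ (n + 2)]
    simp only [← hX.blockTraceSeries_raise_lower a b (Nat.succ_ne_zero _), coeff_blockTraceSeries]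
    congr 1
    refine Finset.sum_congr rfl fun i _ => ?_
    congr 3 <;> push_cast <;> ring
  -- The terms $i=1$ and $i=0$ are split off: the wanted product of zero modes and the misordered
  -- one. The others have $k=i-1\ge1$.
  have h5 : ∑ i ∈ Finset.range (n + 2), X.blockTrace n (X.mode b (2 - i) * X.mode a i) =
      ∑ i ∈ Finset.range n, PowerSeries.coeff n
        (multiplesSeries (i + 1) * hX.commutatorSeries a b (i + 1)) +
      X.blockTrace n (X.mode b 1 * X.mode a 1) + X.blockTrace n (X.mode b 2 * X.mode a 0) := by
    rw [Finset.sum_range_succ', Finset.sum_range_succ']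
    simp only [← hX.blockTraceSeries_lower_raise a b (Nat.succ_ne_zero _), coeff_blockTraceSeries]
    congr 1
    congr 1
    refine Finset.sum_congr rfl fun i _ => ?_
    congr 3; push_cast; ring
  rw [hX.sum_coeff_commutatorSeries a b (by omega)] at h4 h5
  rw [Finset.sum_add_distrib, h5] at h1
  simp only [map_sub, coeff_blockTraceSeries, h1, PowerSeries.coeff_smul, smul_eq_mul]
  have h6 : PowerSeries.coeff n
      ((1 + 2 * sigmaSeries 1) * X.blockTraceSeries (X.mode (X.mode a 1 b) 1)) =
      X.blockTrace n (X.mode (X.mode a 1 b) 1) +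
        2 * PowerSeries.coeff n (sigmaSeries 1 * X.blockTraceSeries (X.mode (X.mode a 1 b) 1)) := by
    rw [add_mul, one_mul, map_add, coeff_blockTraceSeries, mul_assoc, two_mul, map_add, two_mul]
  simp only [map_add, PowerSeries.coeff_smul, smul_eq_mul] at h4 h6 ⊢
  linear_combination -h4 - h2 - h3 + h6

end HasGriessGrading

end VertexOperatorAlgebra

/-! ### The Virasoro submodule in low degrees -/

namespace VertexOperatorAlgebra

variable {V : Type*} [AddCommGroup V] [Module ℂ V] (X : VertexOperatorAlgebra V)

section VirasoroSubmodule

theorem L_vac {m : ℤ} (hm : -1 ≤ m) : X.L m X.vac = 0 :=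
  X.mode_vac_of_nonneg _ _ (by omega)

theorem L_mul_L (m n : ℤ) (v : V) :
    X.L m (X.L n v) = X.L n (X.L m v) + ((m : ℂ) - n) • X.L (m + n) v +
      if m + n = 0 then (((m : ℂ) ^ 3 - m) / 12 * X.c) • v else 0 := by
  have h := LinearMap.congr_fun (X.virasoro m n) v
  have h' : X.L m (X.L n v) - X.L n (X.L m v) = ((m : ℂ) - n) • X.L (m + n) v +
      (if m + n = 0 then (((m : ℂ) ^ 3 - m) / 12 * X.c) • (1 : Module.End ℂ V) else 0) v := h
  rw [sub_eq_iff_eq_add] at h'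
  rw [h']
  split_ifs <;> simp <;> abel

/-- The Virasoro submodule is generated from the vacuum by the operators `L_m` with `m ≤ -2`. -/
theorem virasoroSubmodule_le {W : Submodule ℂ V} (hvac : X.vac ∈ W)
    (h : ∀ m : ℤ, m ≤ -2 → ∀ v ∈ W, X.L m v ∈ W) : X.virasoroSubmodule ≤ W := by
  let S : Set (Submodule ℂ V) := {W | X.vac ∈ W ∧ ∀ m : ℤ, m ≤ -2 → ∀ v ∈ W, X.L m v ∈ W}
  have hU1 : X.vac ∈ sInf S := Submodule.mem_sInf.2 fun W hW => hW.1
  have hU2 : ∀ m : ℤ, m ≤ -2 → ∀ v ∈ sInf S, X.L m v ∈ sInf S := fun m hm v hv =>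
    Submodule.mem_sInf.2 fun W hW => hW.2 m hm v (Submodule.mem_sInf.1 hv W hW)
  -- Minimality of `sInf S` is applied to its vectors that every $L_m$ keeps inside; the Virasoro
  -- relations show that these again form a member of `S`.
  have hU : sInf S ≤ sInf S ⊓ ⨅ m : ℤ, (sInf S).comap (X.L m) := by
    refine sInf_le (show _ ∧ _ from ⟨?_, ?_⟩)
    · refine Submodule.mem_inf.2 ⟨hU1, (Submodule.mem_iInf _).2 fun m => ?_⟩
      rw [Submodule.mem_comap]
      rcases le_or_gt m (-2) with hm | hm
      · exact hU2 m hm _ hU1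
      · rw [X.L_vac (by omega)]; exact zero_mem _
    · intro n hn v hv
      rw [Submodule.mem_inf, Submodule.mem_iInf] at hv
      refine Submodule.mem_inf.2 ⟨hv.2 n, (Submodule.mem_iInf _).2 fun m => ?_⟩
      rw [Submodule.mem_comap, X.L_mul_L]
      refine add_mem (add_mem (hU2 n hn _ (hv.2 m)) (Submodule.smul_mem _ _ (hv.2 _))) ?_
      split_ifs
      · exact Submodule.smul_mem _ _ hv.1
      · exact zero_mem _
  refine (sInf_le ⟨hU1, fun m v hv => ?_⟩ : X.virasoroSubmodule ≤ sInf S).trans (sInf_le ⟨hvac, h⟩)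
  exact (Submodule.mem_iInf _).1 (hU hv).2 m

/-- A graded subspace containing the Virasoro submodule, exact in degrees at most four. -/
def virasoroPiece : ℕ → Submodule ℂ V
  | 0 => Submodule.span ℂ {X.vac}
  | 1 => ⊥
  | 2 => Submodule.span ℂ {X.conf}
  | 3 => Submodule.span ℂ {X.mode X.conf (-2) X.vac}
  | 4 => Submodule.span ℂ {X.mode X.conf (-3) X.vac, X.mode X.conf (-1) X.conf}
  | n + 5 => X.weight (n + 5)

theorem virasoroPiece_of_le {n : ℕ} (hn : 5 ≤ n) : X.virasoroPiece n = X.weight n := by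
  obtain ⟨k, rfl⟩ := Nat.exists_eq_add_of_le' hn
  rfl

theorem vac_mem_weight : X.vac ∈ X.weight 0 := by
  rw [mem_weight]
  have : X.mode X.conf 1 X.vac = 0 := X.mode_vac_of_nonneg _ _ (by norm_num)
  simp [this]

theorem virasoroPiece_le_weight (n : ℕ) : X.virasoroPiece n ≤ X.weight n := by
  match n with
  | 0 => exact (Submodule.span_singleton_le_iff_mem _ _).2 X.vac_mem_weight
  | 1 => exact bot_le
  | 2 => exact (Submodule.span_singleton_le_iff_mem _ _).2 X.conf_mem_weight
  | 3 =>
    exact (Submodule.span_singleton_le_iff_mem _ _).2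
      (X.mode_mem_weight (by norm_num) X.conf_mem_weight X.vac_mem_weight)
  | 4 =>
    refine Submodule.span_le.2 (Set.insert_subset ?_ (Set.singleton_subset_iff.2 ?_))
    · exact X.mode_mem_weight (by norm_num) X.conf_mem_weight X.vac_mem_weight
    · exact X.mode_mem_weight (by norm_num) X.conf_mem_weight X.conf_mem_weight
  | n + 5 => exact le_rfl

theorem virasoroSubmodule_le_iSup : X.virasoroSubmodule ≤ ⨆ n, X.virasoroPiece n := by
  have hle := le_iSup X.virasoroPiece
  apply X.virasoroSubmodule_le
  · exact hle 0 (Submodule.mem_span_singleton_self _)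
  · intro m hm v hv
    have key : ∀ n : ℕ, (5 : ℤ) ≤ n - m → ∀ w ∈ X.virasoroPiece n,
        X.L m w ∈ ⨆ n, X.virasoroPiece n := by
      intro n hn w hw
      have hmem : X.L m w ∈ X.weight (n - m).toNat :=
        X.mode_mem_weight (by push_cast; omega) X.conf_mem_weight (X.virasoroPiece_le_weight n hw)
      rw [← X.virasoroPiece_of_le (by omega)] at hmem
      exact hle _ hmem
    have hgen : ∀ n : ℕ, X.virasoroPiece n ≤ (⨆ n, X.virasoroPiece n).comap (X.L m) := by
      intro n
      by_cases hnm : (5 : ℤ) ≤ n - m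
      · exact fun w hw => key n hnm w hw
      -- Degrees at least 5 are unconstrained and $L_m$ raises degree by $-m\ge2$, so only starting
      -- degrees at most 2 need checking.
      · have hn : n ≤ 2 := by omega
        interval_cases n
        · refine (Submodule.span_singleton_le_iff_mem _ _).2 (Submodule.mem_comap.2 ?_)
          have : -4 ≤ m := by push_cast at hnm; omega
          interval_cases m
          · exact hle 4 (Submodule.subset_span (Set.mem_insert _ _))
          · exact hle 3 (Submodule.mem_span_singleton_self _)
          · have : X.L (-2) X.vac = X.conf := X.mode_vac_neg_one _
            rw [this]
            exact hle 2 (Submodule.mem_span_singleton_self _)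
        · exact bot_le
        · refine (Submodule.span_singleton_le_iff_mem _ _).2 (Submodule.mem_comap.2 ?_)
          obtain rfl : m = -2 := by push_cast at hnm; omega
          exact hle 4 (Submodule.subset_span (Set.mem_insert_of_mem _ rfl))
    exact iSup_le hgen hv

theorem virasoroSubmodule_inf_weight_le (m : ℕ) :
    X.virasoroSubmodule ⊓ X.weight m ≤ X.virasoroPiece m := by
  rintro v ⟨hv, hvm⟩
  have hle : ⨆ n, X.virasoroPiece n ≤ X.virasoroPiece m ⊔ ⨆ (j) (_ : j ≠ m), X.weight j := by
    refine iSup_le fun n => ?_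
    rcases eq_or_ne n m with rfl | hn
    · exact le_sup_left
    · exact (X.virasoroPiece_le_weight n).trans
        (le_sup_of_le_right (le_iSup₂_of_le n hn le_rfl))
  obtain ⟨x, hx, y, hy, rfl⟩ := Submodule.mem_sup.1 (hle (X.virasoroSubmodule_le_iSup hv))
  have hy' : y ∈ X.weight m := by
    have := sub_mem hvm (X.virasoroPiece_le_weight m hx)
    rwa [add_sub_cancel_left] at this
  have := (Submodule.disjoint_def.1 (X.isInternal_weight.submodule_iSupIndep m)) y hy' hy
  rwa [this, add_zero]

end VirasoroSubmodule

/-! ### Averaging over the automorphism group -/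

section Automorphism

variable {X}

theorem map_vac_of_mem_Aut {g : V ≃ₗ[ℂ] V} (hg : g ∈ X.Aut) : g X.vac = X.vac := by
  have h := hg.1 X.vac (g.symm X.vac) (-1)
  have h1 : X.mode X.vac (-1) (g.symm X.vac) = g.symm X.vac := by
    have := X.vac_mode (-1) (g.symm X.vac)
    rwa [if_pos rfl] at this
  have h2 : X.mode (g X.vac) (-1) X.vac = g X.vac := X.mode_vac_neg_one _
  rw [h1, g.apply_symm_apply, h2] at h
  exact h.symm

theorem map_mode_conf {g : V ≃ₗ[ℂ] V} (hg : g ∈ X.Aut) (n : ℤ) (v : V) :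
    g (X.mode X.conf n v) = X.mode X.conf n (g v) := by
  rw [hg.1, hg.2]

theorem map_mem_intWeight {g : V ≃ₗ[ℂ] V} (hg : g ∈ X.Aut) {m : ℤ} {v : V}
    (hv : v ∈ X.intWeight m) : g v ∈ X.intWeight m := by
  rw [mem_intWeight] at *
  rw [← map_mode_conf hg, hv, map_smul]

/-- Conjugate operators have equal traces: $(gu)_{(n)}=g\,u_{(n)}g^{-1}$. -/
theorem blockTrace_mode_map {g : V ≃ₗ[ℂ] V} (hg : g ∈ X.Aut) {k n : ℤ} (hk : k = n + 1) (m : ℤ)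
    {u : V} (hu : u ∈ X.intWeight k) :
    X.blockTrace m (X.mode (g u) n) = X.blockTrace m (X.mode u n) := by
  have hg' : g.symm ∈ X.Aut := X.Aut.inv_mem hg
  have h1 : X.mode (g u) n = (g.toLinearMap * X.mode u n) * g.symm.toLinearMap := by
    ext v
    simp [hg.1]
  rw [h1, X.blockTrace_mul_comm (m := m) (n := m) (f := g.symm.toLinearMap)
    (g := g.toLinearMap * X.mode u n) (fun v hv => map_mem_intWeight hg' hv)
    (fun v hv => map_mem_intWeight hg (X.mode_mem_intWeight (by omega) hu hv))]
  congr 1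
  ext v
  simp

variable (X) in
/-- The projection to the vectors fixed by a finite automorphism group. -/
def average [Finite X.Aut] : V →ₗ[ℂ] V :=
  letI := Fintype.ofFinite X.Aut
  (Fintype.card X.Aut : ℂ)⁻¹ • ∑ g : X.Aut, (g : V ≃ₗ[ℂ] V).toLinearMap

theorem average_apply [Finite X.Aut] [Fintype X.Aut] (v : V) :
    X.average v = (Fintype.card X.Aut : ℂ)⁻¹ • ∑ g : X.Aut, (g : V ≃ₗ[ℂ] V) v := by
  simp only [average, LinearMap.smul_apply, LinearMap.sum_apply, LinearEquiv.coe_coe]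
  congr!

theorem map_average [Finite X.Aut] {M : Type*} [AddCommGroup M] [Module ℂ M] (f : V →ₗ[ℂ] M)
    {v : V} (h : ∀ g ∈ X.Aut, f (g v) = f v) : f (X.average v) = f v := by
  have := Fintype.ofFinite X.Aut
  rw [average_apply, map_smul, map_sum, Finset.sum_congr rfl fun (g : X.Aut) _ => h g g.2,
    Finset.sum_const, Finset.card_univ, ← Nat.cast_smul_eq_nsmul ℂ, smul_smul,
    inv_mul_cancel₀ (Nat.cast_ne_zero.2 Fintype.card_ne_zero), one_smul]

theorem average_fixed [Finite X.Aut] {g : V ≃ₗ[ℂ] V} (hg : g ∈ X.Aut) (v : V) :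
    g (X.average v) = X.average v := by
  have := Fintype.ofFinite X.Aut
  rw [average_apply, map_smul, map_sum]
  congr 1
  exact Fintype.sum_equiv (Equiv.mulLeft (⟨g, hg⟩ : X.Aut)) _ _ fun _ => rfl

theorem average_mem_weight [Finite X.Aut] {n : ℕ} {v : V} (hv : v ∈ X.weight n) :
    X.average v ∈ X.weight n := by
  have := Fintype.ofFinite X.Aut
  rw [average_apply]
  rw [← intWeight_natCast] at *
  exact Submodule.smul_mem _ _ (Submodule.sum_mem _ fun g _ => map_mem_intWeight g.2 hv)

/-- An average is fixed, so its class modulo $V_\omega^{\le n}$ is fixed and therefore zero. -/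
theorem IsClassS.average_mem [Finite X.Aut] {m n : ℕ} (hS : X.IsClassS n) (hmn : m ≤ n) {v : V}
    (hv : v ∈ X.weight m) : X.average v ∈ X.virasoroPiece m := by
  have h1 := average_mem_weight hv
  have h2 : X.weight m ≤ X.weightLE n :=
    le_iSup₂_of_le m (Finset.mem_range.2 (by omega)) le_rfl
  have h3 := hS _ (h2 h1) fun g hg => by rw [average_fixed hg, sub_self]; exact zero_mem _
  exact X.virasoroSubmodule_inf_weight_le m ⟨h3.1, h1⟩

theorem IsClassS.mono {m n : ℕ} (hS : X.IsClassS n) (hmn : m ≤ n) : X.IsClassS m := by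
  have hle : X.weightLE m ≤ X.weightLE n := by
    refine iSup₂_le fun k hk => ?_
    rw [Finset.mem_range] at hk
    exact le_iSup₂_of_le k (Finset.mem_range.2 (by omega)) le_rfl
  intro v hv h
  exact ⟨(hS v (hle hv) fun g hg => ⟨(h g hg).1, hle (h g hg).2⟩).1, hv⟩

theorem blockTrace_mode_average [Finite X.Aut] {k n : ℤ} (hk : k = n + 1) (m : ℤ)
    {u : V} (hu : u ∈ X.intWeight k) :
    X.blockTrace m (X.mode (X.average u) n) = X.blockTrace m (X.mode u n) :=
  map_average (X.blockTrace m ∘ₗ X.modeL n) fun _ hg => blockTrace_mode_map hg hk m hu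

end Automorphism

/-! ### Traces of single zero modes in degrees 2 and 4 -/

section Traces

theorem mode_conf_three_conf : X.mode X.conf 3 X.conf = (X.c / 2) • X.vac := by
  have h := X.L_mul_L 2 (-2) X.vac
  rw [X.L_vac (m := 2) (by norm_num), X.L_vac (m := 2 + -2) (by norm_num)] at h
  have e : X.L (-2) X.vac = X.conf := X.mode_vac_neg_one _
  rw [e] at h
  norm_num at h
  refine (h : X.mode X.conf 3 X.conf = _).trans ?_
  congr 1; ring

theorem mode_conf_five_descendant :
    X.mode X.conf 5 (X.mode X.conf (-3) X.vac) = (5 * X.c) • X.vac := by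
  have h := X.L_mul_L 4 (-4) X.vac
  rw [X.L_vac (m := 4) (by norm_num), X.L_vac (m := 4 + -4) (by norm_num)] at h
  norm_num at h
  exact h

theorem mode_conf_three_descendant :
    X.mode X.conf 3 (X.mode X.conf 3 (X.mode X.conf (-3) X.vac)) = (3 * X.c) • X.vac := by
  have h := X.L_mul_L 2 (-4) X.vac
  rw [X.L_vac (m := 2) (by norm_num)] at h
  norm_num at h
  have e : X.L (-2) X.vac = X.conf := X.mode_vac_neg_one _
  rw [e] at h
  have h' : X.mode X.conf 3 (X.mode X.conf (-3) X.vac) = (6 : ℂ) • X.conf := h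
  rw [h', map_smul, mode_conf_three_conf, smul_smul]
  congr 1; ring

/-- Here $L_{-4}\mathbf 1=\frac12L_{-1}^2\omega$, and two translations give the factor
$\frac12(-3)(-2)=3$. -/
theorem mode_descendant : X.mode (X.mode X.conf (-3) X.vac) 3 = (3 : ℂ) • X.mode X.conf 1 := by
  have t : ∀ (a : V) (n : ℤ), X.mode (X.mode X.conf 0 a) n = (-(n : ℂ)) • X.mode a (n - 1) :=
    X.translation
  have h : X.mode X.conf 0 (X.mode X.conf 0 X.conf) = (2 : ℂ) • X.mode X.conf (-3) X.vac := by
    have e : X.mode (X.mode X.conf 0 (X.mode X.conf 0 X.conf)) (-1) X.vac =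
      X.mode X.conf 0 (X.mode X.conf 0 X.conf) := X.mode_vac_neg_one _
    rw [← e, t, t]
    norm_num
  have h2 := t (X.mode X.conf 0 X.conf) 3
  rw [h, mode_smul, t, smul_smul] at h2
  norm_num at h2
  rw [show (6 : ℂ) = 2 * 3 by norm_num, mul_smul] at h2
  exact smul_right_injective _ two_ne_zero h2

variable {X}

theorem blockTrace_of_isClassS_two [Finite X.Aut] (hS : X.IsClassS 2) (hc : X.c ≠ 0) {u : V}
    (hu : u ∈ X.weight 2) {r : ℂ} (hr : X.mode X.conf 3 u = r • X.vac) (m : ℤ) :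
    X.blockTrace m (X.mode u 1) = 2 * r / X.c * X.blockTrace m (X.mode X.conf 1) := by
  obtain ⟨l, hl⟩ := Submodule.mem_span_singleton.1 (hS.average_mem le_rfl hu)
  have h1 : X.mode X.conf 3 (X.average u) = r • X.vac := by
    rw [map_average (X.mode X.conf 3), hr]
    intro g hg
    rw [← map_mode_conf hg, hr, map_smul, map_vac_of_mem_Aut hg]
  rw [← hl, map_smul, mode_conf_three_conf, smul_smul] at h1
  have h2 := smul_left_injective ℂ X.vac_ne_zero h1
  rw [← intWeight_natCast] at hu
  rw [← blockTrace_mode_average (n := 1) rfl m hu, ← hl, mode_smul, map_smul, smul_eq_mul, ← h2]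
  field_simp

namespace HasGriessGrading

theorem form_confB_confB (hX : X.HasGriessGrading) : hX.form X.confB X.confB = X.c / 2 :=
  hX.form_eq X.mode_conf_three_conf

theorem mode_conf_three (hX : X.HasGriessGrading) (a : X.griess) :
    X.mode X.conf 3 (a : V) = hX.form a X.confB • X.vac := by
  rw [hX.form_comm]
  exact (hX.form_smul_vac X.confB a).symm

theorem mode_conf_three_mode_one (hX : X.HasGriessGrading) (a b : X.griess) :
    X.mode X.conf 3 (X.mode a 1 (b : V)) = (2 * hX.form a b) • X.vac := by
  have e1 : X.mode a 1 X.vac = 0 := X.mode_vac_of_nonneg _ _ (by norm_num)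
  have e2 : X.mode X.vac 1 (b : V) = 0 := by
    have := X.vac_mode 1 (b : V)
    rwa [if_neg (by norm_num)] at this
  rw [hX.conf_commutator, hX.mode_conf_three, map_smul, e1]
  norm_num
  rw [e2, ← hX.form_smul_vac, smul_zero, add_zero, smul_smul]

theorem mode_conf_five_mode_neg_one (hX : X.HasGriessGrading) (a b : X.griess) :
    X.mode X.conf 5 (X.mode a (-1) (b : V)) = (6 * hX.form a b) • X.vac := by
  have e1 : X.mode X.conf 5 (b : V) = 0 :=
    X.mode_eq_zero (by norm_num) (griess_mem_intWeight X.confB) (griess_mem_intWeight b)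
  have e2 : X.mode X.vac 1 (b : V) = 0 := by
    have := X.vac_mode 1 (b : V)
    rwa [if_neg (by norm_num)] at this
  rw [hX.conf_commutator, e1]
  norm_num
  rw [e2, ← hX.form_smul_vac, smul_zero, add_zero, smul_smul]

/-- One application of $L_2$ gives $(b|\omega)a+4a_{(1)}b+(a|\omega)b$; the second uses
$L_2(a_{(1)}b)=2(a|b)\mathbf 1$. -/
theorem mode_conf_three_mode_neg_one (hX : X.HasGriessGrading) (a b : X.griess) :
    X.mode X.conf 3 (X.mode X.conf 3 (X.mode a (-1) (b : V))) =
      (8 * hX.form a b + 2 * (hX.form a X.confB * hX.form b X.confB)) • X.vac := by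
  have e1 : X.mode a (-1) X.vac = a := X.mode_vac_neg_one _
  have e2 : X.mode X.vac (-1) (b : V) = b := by
    have := X.vac_mode (-1) (b : V)
    rwa [if_pos rfl] at this
  rw [hX.conf_commutator a 3, hX.mode_conf_three b, map_smul, e1]
  norm_num
  rw [e2, hX.mode_conf_three_mode_one, hX.mode_conf_three, hX.mode_conf_three]
  module

/-- The average of $u$ is $xL_{-4}\mathbf 1+y\,\omega_{(-1)}\omega$; comparing its images under
$L_4$ and $L_2^2$ with those of $u$ gives the linear system. Its determinant is $c^2(5c+22)/2$,
whence the condition on $c$. -/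
theorem blockTrace_of_isClassS_four [Finite X.Aut] (hX : X.HasGriessGrading) (hS : X.IsClassS 4)
    {u : V} (hu : u ∈ X.weight 4) {r s : ℂ} (hr : X.mode X.conf 5 u = r • X.vac)
    (hs : X.mode X.conf 3 (X.mode X.conf 3 u) = s • X.vac) :
    ∃ x y : ℂ, 5 * X.c * x + 3 * X.c * y = r ∧ 3 * X.c * x + X.c * (8 + X.c) / 2 * y = s ∧
      ∀ m, X.blockTrace m (X.mode u 3) = 3 * x * X.blockTrace m (X.mode X.conf 1) +
        y * X.blockTrace m (X.mode (X.mode X.conf (-1) X.conf) 3) := by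
  obtain ⟨x, y, hxy⟩ := Submodule.mem_span_pair.1 (hS.average_mem le_rfl hu)
  have h1 : X.mode X.conf 5 (X.average u) = r • X.vac := by
    rw [map_average (X.mode X.conf 5), hr]
    intro g hg
    rw [← map_mode_conf hg, hr, map_smul, map_vac_of_mem_Aut hg]
  have h2 : X.mode X.conf 3 (X.mode X.conf 3 (X.average u)) = s • X.vac := by
    rw [← Module.End.mul_apply, map_average (X.mode X.conf 3 * X.mode X.conf 3),
      Module.End.mul_apply, hs]
    intro g hg
    rw [Module.End.mul_apply, Module.End.mul_apply, ← map_mode_conf hg, ← map_mode_conf hg, hs,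
      map_smul, map_vac_of_mem_Aut hg]
  have e5 := hX.mode_conf_five_mode_neg_one X.confB X.confB
  have e3 := hX.mode_conf_three_mode_neg_one X.confB X.confB
  rw [hX.form_confB_confB] at e5 e3
  change X.mode X.conf 5 (X.mode X.conf (-1) X.conf) = _ at e5
  change X.mode X.conf 3 (X.mode X.conf 3 (X.mode X.conf (-1) X.conf)) = _ at e3
  rw [← hxy] at h1 h2
  simp only [map_add, map_smul, e5, e3, mode_conf_five_descendant, mode_conf_three_descendant,
    smul_smul, ← add_smul] at h1 h2
  have h1' := smul_left_injective ℂ X.vac_ne_zero h1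
  have h2' := smul_left_injective ℂ X.vac_ne_zero h2
  refine ⟨x, y, by linear_combination h1', by linear_combination h2', fun m => ?_⟩
  rw [← intWeight_natCast] at hu
  rw [← blockTrace_mode_average (n := 3) rfl m hu, ← hxy, mode_add, mode_smul, mode_smul,
    mode_descendant]
  simp only [map_add, map_smul, smul_eq_mul]
  ring

end HasGriessGrading

end Traces

end VertexOperatorAlgebra

/-! ### Eisenstein series and elimination of the unknown trace -/

theorem twelve_mul_eisensteinQ_two : 12 * eisensteinQ 2 = 24 * sigmaSeries 1 - 1 := by
  rw [← map_ofNat PowerSeries.C 12,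
    ← map_ofNat PowerSeries.C 24]
  ext n
  rw [map_sub, PowerSeries.coeff_C_mul, PowerSeries.coeff_C_mul, PowerSeries.coeff_one,
    eisensteinQ, sigmaSeries, PowerSeries.coeff_mk, PowerSeries.coeff_mk]
  split_ifs with h
  · norm_num [h, bernoulli_two]
  · push_cast
    norm_num
    ring

theorem eisensteinQ_four_mul : 720 * eisensteinQ 4 = 240 * sigmaSeries 3 + 1 := by
  rw [← map_ofNat PowerSeries.C 720,
    ← map_ofNat PowerSeries.C 240]
  ext n
  have hb : bernoulli 4 = -1 / 30 := by
    rw [bernoulli_eq_bernoulli'_of_ne_one (by norm_num), bernoulli'_four]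
  rw [map_add, PowerSeries.coeff_C_mul, PowerSeries.coeff_C_mul, PowerSeries.coeff_one,
    eisensteinQ, sigmaSeries, PowerSeries.coeff_mk, PowerSeries.coeff_mk]
  split_ifs with h
  · norm_num [h, hb, Nat.factorial]
  · push_cast
    norm_num [Nat.factorial]
    ring

/-- Elimination of the unknown traces in the computation of the trace of a product. -/
theorem trace_product_elimination {c f g x y : ℂ} (hc : c * (5 * c + 22) ≠ 0)
    (h1 : 5 * c * x + 3 * c * y = 6 * f) (h2 : 3 * c * x + c * (8 + c) / 2 * y = 8 * f + 2 * g)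
    {G A Λ D D₂ ch : ℂ⟦X⟧} (hA : A = (3 * x) • D + y • Λ)
    (hG : G = A - (1 + 2 * sigmaSeries 1) * ((4 * f / c) • D) -
      (f / 3) • ((sigmaSeries 3 - sigmaSeries 1) * ch))
    (hD : D₂ = Λ - (1 + 2 * sigmaSeries 1) * ((2 : ℂ) • D) -
      (c / 6) • ((sigmaSeries 3 - sigmaSeries 1) * ch)) :
    G = ((44 * f + 20 * g) / (c * (5 * c + 22))) • D₂ -
      ((c * f - 2 * g) / (3 * c * (5 * c + 22))) • ((11 + 60 * eisensteinQ 2) * D) +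
      ((c * f - 2 * g) / (144 * (5 * c + 22))) •
        ((11 + 120 * eisensteinQ 2 - 720 * eisensteinQ 4) * ch) := by
  obtain ⟨hc0, hc1⟩ := mul_ne_zero_iff.1 hc
  -- Expressing $f=(a|b)$ and $g=(a|\omega)(b|\omega)$ through $x,y$, rather than conversely, turns
  -- all the coefficients into polynomials.
  have hf : f = c * (5 * x + 3 * y) / 6 := by linear_combination -h1 / 6
  have hg : g = (3 * c * x + c * (8 + c) / 2 * y - 8 * f) / 2 := by linear_combination -h2 / 2
  have k1 : (44 * f + 20 * g) / (c * (5 * c + 22)) = y := by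
    rw [div_eq_iff hc, hg, hf]; ring
  have k2 : c * f - 2 * g = c * (5 * c + 22) * (x / 6) := by rw [hg, hf]; ring
  have k3 : (c * f - 2 * g) / (3 * c * (5 * c + 22)) = x / 18 := by
    rw [k2, div_eq_div_iff (by simp [hc0, hc1]) (by norm_num)]; ring
  have k4 : (c * f - 2 * g) / (144 * (5 * c + 22)) = c * x / 864 := by
    rw [k2, div_eq_div_iff (by simp [hc1]) (by norm_num)]; ring
  have k5 : 4 * f / c = 2 * (5 * x + 3 * y) / 3 := by rw [hf]; field_simp; ring
  rw [k1, k3, k4, hG, k5, hA, hD, hf]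
  -- Rescaling clears the numerical denominators, so that `PowerSeries.C` meets only numerals and
  -- variables.
  obtain ⟨z, rfl⟩ : ∃ z, x = 864 * z := ⟨x / 864, by ring⟩
  obtain ⟨w, rfl⟩ : ∃ w, y = 18 * w := ⟨y / 18, by ring⟩
  obtain ⟨d, rfl⟩ : ∃ d, c = 6 * d := ⟨c / 6, by ring⟩
  rw [show 864 * z / 18 = 48 * z by ring, show 6 * d * (864 * z) / 864 = 6 * d * z by ring,
    show 2 * (5 * (864 * z) + 3 * (18 * w)) / 3 = 2880 * z + 36 * w by ring,
    show 6 * d * (5 * (864 * z) + 3 * (18 * w)) / 6 / 3 = d * (1440 * z + 18 * w) by ring,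
    show 6 * d / 6 = d by ring]
  simp only [PowerSeries.smul_eq_C_mul, map_mul, map_add, map_ofNat]
  linear_combination (240 * PowerSeries.C z * D - 60 * PowerSeries.C d * PowerSeries.C z * ch) *
    twelve_mul_eisensteinQ_two + 6 * PowerSeries.C d * PowerSeries.C z * ch * eisensteinQ_four_mul

/-! ### Assembly of the trace formulas -/

namespace VertexOperatorAlgebra

namespace HasGriessGrading

variable {V : Type*} [AddCommGroup V] [Module ℂ V] {X : VertexOperatorAlgebra V}

theorem blockTraceSeries_of_isClassS_two [Finite X.Aut] (hS : X.IsClassS 2)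
    (hc : X.c ≠ 0) {u : V} (hu : u ∈ X.weight 2) {r : ℂ} (hr : X.mode X.conf 3 u = r • X.vac) :
    X.blockTraceSeries (X.mode u 1) = (2 * r / X.c) • qDeriv X.ch := by
  ext n
  rw [coeff_blockTraceSeries, blockTrace_of_isClassS_two hS hc hu hr, X.blockTrace_conf,
    PowerSeries.coeff_smul, smul_eq_mul]

theorem blockTraceSeries_conf_mul_conf :
    X.blockTraceSeries (X.mode X.conf 1 * X.mode X.conf 1) = qDeriv (qDeriv X.ch) := by
  ext n
  rw [coeff_blockTraceSeries, X.blockTrace_conf_mul, X.blockTrace_conf, coeff_qDeriv (qDeriv _)]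

theorem traceSeries_eq (f : Module.End ℂ V) (hf : X.PreservesDegree f) :
    X.traceSeries f hf = X.blockTraceSeries f := by
  ext n
  rw [X.coeff_traceSeries, coeff_blockTraceSeries]

end HasGriessGrading

end VertexOperatorAlgebra

end

theorem theorem3 {V : Type*} [AddCommGroup V] [Module ℂ V] (X : VertexOperatorAlgebra V)
    (hX : X.HasGriessGrading) (hfin : Finite X.Aut) :
    (X.IsClassS 2 → X.c ≠ 0 → ∀ a : X.griess,
      X.traceSeries (X.o a) (X.preservesDegree_o a) =
        (2 * hX.form a X.confB / X.c) • qDeriv X.ch) ∧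
    (X.IsClassS 4 → X.c * (5 * X.c + 22) ≠ 0 → ∀ a b : X.griess,
      X.traceSeries (X.o a * X.o b) ((X.preservesDegree_o a).mul (X.preservesDegree_o b)) =
        ((44 * hX.form a b + 20 * (hX.form a X.confB * hX.form b X.confB)) /
            (X.c * (5 * X.c + 22))) • qDeriv (qDeriv X.ch)
        - ((X.c * hX.form a b - 2 * (hX.form a X.confB * hX.form b X.confB)) /
            (3 * X.c * (5 * X.c + 22))) • ((11 + 60 * eisensteinQ 2) * qDeriv X.ch)
        + ((X.c * hX.form a b - 2 * (hX.form a X.confB * hX.form b X.confB)) /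
            (144 * (5 * X.c + 22))) •
            ((11 + 120 * eisensteinQ 2 - 720 * eisensteinQ 4) * X.ch)) := by
  refine ⟨fun hS hc a => ?_, fun hS hc a b => ?_⟩
  · rw [VertexOperatorAlgebra.HasGriessGrading.traceSeries_eq]
    exact VertexOperatorAlgebra.HasGriessGrading.blockTraceSeries_of_isClassS_two hS hc a.2
      (hX.mode_conf_three a)
  · have hc0 : X.c ≠ 0 := left_ne_zero_of_mul hc
    have hS2 := hS.mono (m := 2) (by norm_num)
    have hprod : (X.mode a (-1) (b : V)) ∈ X.weight 4 := X.mode_mem_weight (by norm_num) a.2 b.2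
    have hT : ∀ a b : X.griess, X.blockTraceSeries (X.mode (X.mode a 1 b) 1) =
        (4 * hX.form a b / X.c) • qDeriv X.ch := by
      intro a b
      have hm : X.mode a 1 (b : V) ∈ X.weight 2 := X.mode_mem_weight (by norm_num) a.2 b.2
      rw [VertexOperatorAlgebra.HasGriessGrading.blockTraceSeries_of_isClassS_two hS2 hc0 hm
        (hX.mode_conf_three_mode_one a b)]
      congr 1; ring
    obtain ⟨x, y, h1, h2, h3⟩ := hX.blockTrace_of_isClassS_four hS hprod
      (hX.mode_conf_five_mode_neg_one a b) (hX.mode_conf_three_mode_neg_one a b)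
    have hA : X.blockTraceSeries (X.mode (X.mode a (-1) b) 3) = (3 * x) • qDeriv X.ch +
        y • X.blockTraceSeries (X.mode (X.mode X.conf (-1) X.conf) 3) := by
      ext n
      simp only [map_add, PowerSeries.coeff_smul, smul_eq_mul,
        VertexOperatorAlgebra.HasGriessGrading.coeff_blockTraceSeries]
      rw [h3, X.blockTrace_conf]
    have hG := hX.blockTraceSeries_mode_mul_mode a b
    -- At $a=b=\omega$ the left side is $(q\,d/dq)^2\mathrm{ch}\,V$, which determines the unknown
    -- trace of $(\omega_{(-1)}\omega)_{(3)}$.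
    have hD := hX.blockTraceSeries_mode_mul_mode X.confB X.confB
    rw [hT] at hG hD
    rw [hX.form_confB_confB] at hD
    change X.blockTraceSeries (X.mode X.conf 1 * X.mode X.conf 1) =
      X.blockTraceSeries (X.mode (X.mode X.conf (-1) X.conf) 3) - _ - _ at hD
    rw [VertexOperatorAlgebra.HasGriessGrading.blockTraceSeries_conf_mul_conf,
      show 4 * (X.c / 2) / X.c = 2 by field_simp; norm_num, div_div,
      show (2 : ℂ) * 3 = 6 by norm_num] at hD
    rw [VertexOperatorAlgebra.HasGriessGrading.traceSeries_eq]
    exact trace_product_elimination hc h1 h2 hA hG hD
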